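/- Consider contextual slate bandits with $K$ slots, where slot $k$ has the actions $[d_k]=\{1,\dots,d_k\}$. Let $(X_i,A_i,R_i)$, $i=1,2,\dots$, be independent copies of a triple $(X,A,R)$, where the context is $X\sim P_X$, the slate $A=(A_1,\dots,A_K)$ is drawn from a logging policy $\mu(\cdot\mid X)$, and the real reward $R$ is drawn from a conditional distribution $P(\cdot\mid A,X)$. Assume that $\mu$ is factored, $\mu(a\mid x)=\prod_{k=1}^K\mu_k(a_k\mid x)$, where each $\mu_k(\cdot\mid x)$ is a probability distribution on $[d_k]$. Let $\pi(a\mid x)$ be a fixed target policy, with slot marginals $\pi(a_k\mid x)$, such that for almost every context $x$, every $k$ and every $j\in[d_k]$, $\mu_k(j\mid x)=0$ implies that $\pi$ takes action $j$ in slot $k$ with probability $0$. Put $$Y_k=\frac{\pi(A_k\mid X)}{\mu_k(A_k\mid X)},\qquad G=1+\sum_{k=1}^K(Y_k-1),$$ assume that $GR$ is integrable, and let $\theta=\mathbb E[GR]$. For a fixed $w=(w_1,\dots,w_K)\in\mathbb R^K$ put $$\Gamma_w=GR-\sum_{k=1}^K w_k(Y_k-1),\qquad V_w=\operatorname{Var}(\Gamma_w),\qquad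 \hat\theta_n^{(w)}=\frac1n\sum_{i=1}^n\Gamma_w(X_i,A_i,R_i).$$ Then, for every $w\in\mathbb R^K$, $\Gamma_w$ and $\hat\theta_n^{(w)}$ are integrable and $$\mathbb E[\hat\theta_n^{(w)}]=\mathbb E[\Gamma_w]=\theta\qquad\text{for all } n\ge 1;$$ and if $\mathbb E[\Gamma_w^2]<\infty$ (that is, if $V_w$ is finite), then $$\sqrt n\,(\hat\theta_n^{(w)}-\theta)\to_d\mathcal N(0,V_w)\qquad (n\to\infty).$$ -/

import Mathlib

open MeasureTheory ProbabilityTheory Filter Topology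

/-- A slate: in each of the `K` slots `k` one of the `d k` actions. -/
abbrev Slate {K : ℕ} (d : Fin K → ℕ) : Type := (k : Fin K) → Fin (d k)

/-- A data point `(x, a, r)`: context, slate, reward. -/
abbrev Obs (𝓧 : Type*) {K : ℕ} (d : Fin K → ℕ) : Type _ := 𝓧 × Slate d × ℝ

/-- A logging policy `logging (a ∣ x)` is factored, with slot policies `slot k (j ∣ x)`,
if `logging (a ∣ x) = ∏ k, slot k (a k ∣ x)` (for almost every context `x`). -/
def IsFactored {𝓧 : Type*} [MeasurableSpace 𝓧] {K : ℕ} {d : Fin K → ℕ} (PX : Measure 𝓧)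
    (logging : Kernel 𝓧 (Slate d)) (slot : (k : Fin K) → Kernel 𝓧 (Fin (d k))) : Prop :=
  ∀ᵐ x ∂PX, ∀ a : Slate d, logging x {a} = ∏ k, slot k x {a k}

/-- The probability `policy (a_k = j ∣ x)` that a slate policy takes action `j` in slot `k`. -/
noncomputable def slotProb {𝓧 : Type*} [MeasurableSpace 𝓧] {K : ℕ} {d : Fin K → ℕ}
    (policy : Kernel 𝓧 (Slate d)) (k : Fin K) (x : 𝓧) (j : Fin (d k)) : ℝ :=
  (policy x).real {a | a k = j}

/-- Every action that the target policy takes with positive probability in some slot is taken with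
positive probability in that slot by the logging policy (for almost every context). -/
def SlotCoverage {𝓧 : Type*} [MeasurableSpace 𝓧] {K : ℕ} {d : Fin K → ℕ} (PX : Measure 𝓧)
    (target : Kernel 𝓧 (Slate d)) (slot : (k : Fin K) → Kernel 𝓧 (Fin (d k))) : Prop :=
  ∀ᵐ x ∂PX, ∀ (k : Fin K) (j : Fin (d k)), (slot k x).real {j} = 0 → slotProb target k x j = 0

/-- The law of a data point: `X ∼ PX`, `A ∼ logging (· ∣ X)`, `R ∼ reward (· ∣ X, A)`. -/
noncomputable def obsLaw {𝓧 : Type*} [MeasurableSpace 𝓧] {K : ℕ} {d : Fin K → ℕ}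
    (PX : Measure 𝓧) (logging : Kernel 𝓧 (Slate d)) (reward : Kernel (𝓧 × Slate d) ℝ) :
    Measure (Obs 𝓧 d) :=
  PX ⊗ₘ (logging ⊗ₖ reward)

/-- The slot-level density ratio `Y_k = target (A_k ∣ X) / slot k (A_k ∣ X)`. -/
noncomputable def densityRatio {𝓧 : Type*} [MeasurableSpace 𝓧] {K : ℕ} {d : Fin K → ℕ}
    (target : Kernel 𝓧 (Slate d)) (slot : (k : Fin K) → Kernel 𝓧 (Fin (d k)))
    (k : Fin K) (z : Obs 𝓧 d) : ℝ :=
  slotProb target k z.1 (z.2.1 k) / (slot k z.1).real {z.2.1 k}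

/-- `G = 1 + ∑ k, (Y_k - 1)`. -/
noncomputable def ratioSum {𝓧 : Type*} [MeasurableSpace 𝓧] {K : ℕ} {d : Fin K → ℕ}
    (target : Kernel 𝓧 (Slate d)) (slot : (k : Fin K) → Kernel 𝓧 (Fin (d k)))
    (z : Obs 𝓧 d) : ℝ :=
  1 + ∑ k, (densityRatio target slot k z - 1)

/-- The random variable `G R`. -/
noncomputable def weightedReward {𝓧 : Type*} [MeasurableSpace 𝓧] {K : ℕ} {d : Fin K → ℕ}
    (target : Kernel 𝓧 (Slate d)) (slot : (k : Fin K) → Kernel 𝓧 (Fin (d k)))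
    (z : Obs 𝓧 d) : ℝ :=
  ratioSum target slot z * z.2.2

/-- `Γ_w = G R - ∑ k, w_k (Y_k - 1)`. -/
noncomputable def gammaCV {𝓧 : Type*} [MeasurableSpace 𝓧] {K : ℕ} {d : Fin K → ℕ}
    (target : Kernel 𝓧 (Slate d)) (slot : (k : Fin K) → Kernel 𝓧 (Fin (d k)))
    (w : Fin K → ℝ) (z : Obs 𝓧 d) : ℝ :=
  weightedReward target slot z - ∑ k, w k * (densityRatio target slot k z - 1)

/-- The empirical mean `E_n[f] = (1 / n) ∑_{i < n} f (Z_i)` of the first `n` data points. -/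
noncomputable def empMean {Ω S : Type*} (Z : ℕ → Ω → S) (n : ℕ) (f : S → ℝ) (ω : Ω) : ℝ :=
  (1 / (n : ℝ)) * ∑ i ∈ Finset.range n, f (Z i ω)

/-- The control-variate estimator `E_n[Γ_w]`. -/
noncomputable def cvEstimator {𝓧 Ω : Type*} [MeasurableSpace 𝓧] {K : ℕ} {d : Fin K → ℕ}
    (target : Kernel 𝓧 (Slate d)) (slot : (k : Fin K) → Kernel 𝓧 (Fin (d k)))
    (w : Fin K → ℝ) (Z : ℕ → Ω → Obs 𝓧 d) (n : ℕ) (ω : Ω) : ℝ :=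
  empMean Z n (gammaCV target slot w) ω

section ControlVariates

variable {𝓧 : Type*} [MeasurableSpace 𝓧] {K : ℕ} {d : Fin K → ℕ}

/-! Given `X = x`, the factored form makes `A_k` have law `μ_k(· ∣ x)`, so the conditional mean of
`Y_k` is `∑ j, μ_k(j) * (π(j) / μ_k(j)) = ∑ j, π(j) = 1`, where coverage ensures that no mass of `π`
is lost at actions with `μ_k(j) = 0` (`integral_densityRatio_context`). Hence `∑ k, w_k (Y_k - 1)`
has mean zero for every `w`, and subtracting it from `G R` keeps the mean `θ`. Since `w` is fixed,
the estimator averages iid copies of `Γ_w`, and the classical central limit theorem applies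
(`tendstoInDistribution_empMean`). -/

lemma measurable_slotProb (policy : Kernel 𝓧 (Slate d)) (k : Fin K) (j : Fin (d k)) :
    Measurable fun x ↦ slotProb policy k x j :=
  (Kernel.measurable_coe policy (Set.toFinite _).measurableSet).ennreal_toReal

lemma slotProb_nonneg (policy : Kernel 𝓧 (Slate d)) (k : Fin K) (x : 𝓧) (j : Fin (d k)) :
    0 ≤ slotProb policy k x j :=
  measureReal_nonneg

lemma sum_slotProb (policy : Kernel 𝓧 (Slate d)) [IsMarkovKernel policy] (k : Fin K) (x : 𝓧) :
    ∑ j, slotProb policy k x j = 1 := by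
  have h := sum_measureReal_preimage_singleton (μ := policy x) (f := fun a : Slate d ↦ a k)
    (Finset.univ) (fun y _ ↦ (Set.toFinite _).measurableSet)
  simpa [slotProb, Set.preimage] using h

lemma measurable_densityRatio (target : Kernel 𝓧 (Slate d))
    (slot : (k : Fin K) → Kernel 𝓧 (Fin (d k))) (k : Fin K) :
    Measurable (densityRatio target slot k) := by
  have h : Measurable fun p : 𝓧 × Fin (d k) ↦ slotProb target k p.1 p.2 / (slot k p.1).real {p.2} :=
    measurable_from_prod_countable_left fun j ↦ (measurable_slotProb target k j).div
      (Kernel.measurable_coe (slot k) (measurableSet_singleton j)).ennreal_toReal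
  exact h.comp (measurable_fst.prodMk
    ((measurable_pi_apply k).comp (measurable_fst.comp measurable_snd)))

lemma densityRatio_nonneg (target : Kernel 𝓧 (Slate d))
    (slot : (k : Fin K) → Kernel 𝓧 (Fin (d k))) (k : Fin K) (z : Obs 𝓧 d) :
    0 ≤ densityRatio target slot k z :=
  div_nonneg (slotProb_nonneg _ _ _ _) measureReal_nonneg

lemma measurable_gammaCV (target : Kernel 𝓧 (Slate d))
    (slot : (k : Fin K) → Kernel 𝓧 (Fin (d k))) (w : Fin K → ℝ) :
    Measurable (gammaCV target slot w) := by
  have h k := measurable_densityRatio target slot k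
  unfold gammaCV weightedReward ratioSum
  fun_prop

/-- The slot marginals of a factored logging policy are its slot policies. -/
lemma IsFactored.map_eval {PX : Measure 𝓧} {logging : Kernel 𝓧 (Slate d)}
    {slot : (k : Fin K) → Kernel 𝓧 (Fin (d k))} [∀ k, IsMarkovKernel (slot k)]
    (hfac : IsFactored PX logging slot) :
    ∀ᵐ x ∂PX, ∀ k, (logging x).map (fun a : Slate d ↦ a k) = slot k x := by
  filter_upwards [hfac] with x hx k
  -- On a finite space the masses of singletons determine the measure, so the factored policy is a
  -- product measure.
  have h : logging x = Measure.pi fun k ↦ slot k x :=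
    Measure.ext_of_singleton fun a ↦ by rw [hx a, Measure.pi_singleton]
  rw [h]
  exact (measurePreserving_eval (fun k ↦ slot k x) k).map_eq

variable {PX : Measure 𝓧} {logging : Kernel 𝓧 (Slate d)} [IsMarkovKernel logging]
  {slot : (k : Fin K) → Kernel 𝓧 (Fin (d k))} [∀ k, IsMarkovKernel (slot k)]
  {reward : Kernel (𝓧 × Slate d) ℝ} [IsMarkovKernel reward]
  {target : Kernel 𝓧 (Slate d)} [IsMarkovKernel target]

/-- Given almost every context, the conditional mean of a density ratio is one. -/
lemma integral_densityRatio_context (hfac : IsFactored PX logging slot)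
    (hcov : SlotCoverage PX target slot) (k : Fin K) :
    ∀ᵐ x ∂PX, Integrable (fun p ↦ densityRatio target slot k (x, p)) ((logging ⊗ₖ reward) x) ∧
      ∫ p, densityRatio target slot k (x, p) ∂((logging ⊗ₖ reward) x) = 1 := by
  filter_upwards [hfac.map_eval, hcov] with x hx hc
  set f : Fin (d k) → ℝ := fun j ↦ slotProb target k x j / (slot k x).real {j} with hf
  -- The reward kernel is Markov, so forgetting the reward returns the logging policy.
  have hmap : ((logging ⊗ₖ reward) x).map (fun p ↦ p.1 k) = slot k x := by
    have h : logging x = ((logging ⊗ₖ reward) x).map Prod.fst := by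
      rw [← Kernel.fst_apply, Kernel.fst_compProd]
    rw [← hx k, h, Measure.map_map (by fun_prop) measurable_fst]
    rfl
  have hm : AEMeasurable (fun p : Slate d × ℝ ↦ p.1 k) ((logging ⊗ₖ reward) x) := by fun_prop
  have hfi : Integrable f (((logging ⊗ₖ reward) x).map fun p ↦ p.1 k) := by
    rw [hmap]; exact .of_finite
  refine ⟨hfi.comp_aemeasurable hm, ?_⟩
  change ∫ p, f (p.1 k) ∂((logging ⊗ₖ reward) x) = 1
  rw [← integral_map hm hfi.aestronglyMeasurable, hmap, integral_fintype .of_finite,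
    ← sum_slotProb target k x]
  refine Finset.sum_congr rfl fun j _ ↦ ?_
  -- An action of logging probability zero contributes nothing to the integral; coverage makes its
  -- target probability zero too.
  by_cases h : (slot k x).real {j} = 0
  · simp [h, hc k j h]
  · simp only [hf, smul_eq_mul]
    field_simp

/-- The ratio may be unbounded across contexts, but it is nonnegative, so its conditional `L¹` norm
equals its conditional mean, the constant `1`. -/
lemma integrable_densityRatio [IsProbabilityMeasure PX] (hfac : IsFactored PX logging slot)
    (hcov : SlotCoverage PX target slot) (k : Fin K) :
    Integrable (densityRatio target slot k) (obsLaw PX logging reward) := by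
  have h := integral_densityRatio_context (reward := reward) hfac hcov k
  refine (Measure.integrable_compProd_iff
    (measurable_densityRatio target slot k).aestronglyMeasurable).2 ⟨h.mono fun x hx ↦ hx.1, ?_⟩
  refine (integrable_const (1 : ℝ)).congr (h.mono fun x hx ↦ ?_)
  simp_rw [Real.norm_of_nonneg (densityRatio_nonneg _ _ _ _)]
  exact hx.2.symm

lemma integral_densityRatio [IsProbabilityMeasure PX] (hfac : IsFactored PX logging slot)
    (hcov : SlotCoverage PX target slot) (k : Fin K) :
    ∫ z, densityRatio target slot k z ∂(obsLaw PX logging reward) = 1 := by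
  have h := integral_densityRatio_context (reward := reward) hfac hcov k
  rw [obsLaw, Measure.integral_compProd (integrable_densityRatio hfac hcov k),
    integral_congr_ae (h.mono fun x hx ↦ hx.2)]
  simp

instance [IsProbabilityMeasure PX] : IsProbabilityMeasure (obsLaw PX logging reward) := by
  unfold obsLaw; infer_instance

lemma integrable_controlVariate [IsProbabilityMeasure PX] (hfac : IsFactored PX logging slot)
    (hcov : SlotCoverage PX target slot) (w : Fin K → ℝ) :
    Integrable (fun z ↦ ∑ k, w k * (densityRatio target slot k z - 1))
      (obsLaw PX logging reward) :=
  integrable_finsetSum _ fun k _ ↦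
    ((integrable_densityRatio hfac hcov k).sub (integrable_const 1)).const_mul (w k)

lemma integral_controlVariate [IsProbabilityMeasure PX] (hfac : IsFactored PX logging slot)
    (hcov : SlotCoverage PX target slot) (w : Fin K → ℝ) :
    ∫ z, ∑ k, w k * (densityRatio target slot k z - 1) ∂(obsLaw PX logging reward) = 0 := by
  have hi k := integrable_densityRatio (reward := reward) hfac hcov k
  have hs k : Integrable (fun z ↦ w k * (densityRatio target slot k z - 1))
      (obsLaw PX logging reward) := ((hi k).sub (integrable_const 1)).const_mul (w k)
  rw [integral_finsetSum _ fun k _ ↦ hs k]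
  refine Finset.sum_eq_zero fun k _ ↦ ?_
  rw [integral_const_mul, integral_sub (hi k) (integrable_const 1),
    integral_densityRatio hfac hcov k]
  simp

end ControlVariates

lemma integrable_empMean {Ω S : Type*} [MeasurableSpace Ω] {P : Measure Ω} {Z : ℕ → Ω → S}
    {f : S → ℝ} (hf : ∀ i, Integrable (fun ω ↦ f (Z i ω)) P) (n : ℕ) :
    Integrable (empMean Z n f) P :=
  (integrable_finsetSum _ fun i _ ↦ hf i).const_mul _

lemma integral_empMean {Ω S : Type*} [MeasurableSpace Ω] {P : Measure Ω} {Z : ℕ → Ω → S}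
    {f : S → ℝ} {m : ℝ} (hf : ∀ i, Integrable (fun ω ↦ f (Z i ω)) P)
    (hm : ∀ i, ∫ ω, f (Z i ω) ∂P = m) {n : ℕ} (hn : 1 ≤ n) :
    ∫ ω, empMean Z n f ω ∂P = m := by
  simp only [empMean]
  rw [integral_const_mul, integral_finsetSum _ fun i _ ↦ hf i]
  have : (n : ℝ) ≠ 0 := by positivity
  simp only [hm, Finset.sum_const, Finset.card_range, nsmul_eq_mul]
  field_simp

/-- Since `√n / n = 1 / √n`, this puts the scaled error in the form of the central limit theorem. At
`n = 0` both sides vanish. -/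
lemma sqrt_mul_empMean_sub {Ω S : Type*} (Z : ℕ → Ω → S) (n : ℕ) (f : S → ℝ) (m : ℝ) (ω : Ω) :
    √(n : ℝ) * (empMean Z n f ω - m) = (√(n : ℝ))⁻¹ * (∑ i ∈ Finset.range n, f (Z i ω) - n * m) := by
  rcases n.eq_zero_or_pos with rfl | hn
  · simp
  have hn' : (0 : ℝ) < n := by positivity
  have hs : √(n : ℝ) ≠ 0 := (Real.sqrt_pos.2 hn').ne'
  have hsq : √(n : ℝ) ^ 2 = n := Real.sq_sqrt hn'.le
  rw [empMean]
  field_simp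
  rw [hsq]

/-- The central limit theorem for empirical means of a function of iid observations. -/
lemma tendstoInDistribution_empMean {Ω S : Type*} [MeasurableSpace Ω] [MeasurableSpace S]
    {P : Measure Ω} [IsProbabilityMeasure P] {Q : Measure S} {Z : ℕ → Ω → S} {f : S → ℝ}
    (hf : Measurable f) (hlaw : ∀ i, HasLaw (Z i) Q P) (hindep : iIndepFun Z P)
    (hL2 : MemLp f 2 Q) :
    TendstoInDistribution (fun (n : ℕ) ω ↦ √(n : ℝ) * (empMean Z n f ω - ∫ z, f z ∂Q)) atTop
      (id : ℝ → ℝ) (fun _ ↦ P) (gaussianReal 0 (variance f Q).toNNReal) := by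
  have hZ i := (hlaw i).aemeasurable
  have hident i : IdentDistrib (fun ω ↦ f (Z i ω)) (fun ω ↦ f (Z 0 ω)) P P :=
    IdentDistrib.comp ⟨hZ i, hZ 0, (hlaw i).map_eq.trans (hlaw 0).map_eq.symm⟩ hf
  have hmean : ∫ ω, f (Z 0 ω) ∂P = ∫ z, f z ∂Q :=
    (hlaw 0).integral_comp hf.aestronglyMeasurable
  have hvar : variance (fun ω ↦ f (Z 0 ω)) P = variance f Q := by
    rw [← (hlaw 0).map_eq, variance_map hf.aemeasurable (hZ 0)]
    rfl
  have hmem : MemLp (fun ω ↦ f (Z 0 ω)) 2 P := by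
    rw [← (hlaw 0).map_eq] at hL2
    exact hL2.comp_of_map (hZ 0)
  simp_rw [sqrt_mul_empMean_sub, ← hmean, ← hvar]
  exact tendstoInDistribution_inv_sqrt_mul_sum_sub (X := fun i ω ↦ f (Z i ω))
    HasLaw.id hmem (hindep.comp (fun _ ↦ f) fun _ ↦ hf) hident

theorem lemma2 {𝓧 Ω : Type*} [MeasurableSpace 𝓧] [MeasurableSpace Ω]
    {K : ℕ} {d : Fin K → ℕ}
    -- the distribution of contexts, the logging policy and its slot policies, the rewards
    (PX : Measure 𝓧) [IsProbabilityMeasure PX]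
    (logging : Kernel 𝓧 (Slate d)) [IsMarkovKernel logging]
    (slot : (k : Fin K) → Kernel 𝓧 (Fin (d k))) [∀ k, IsMarkovKernel (slot k)]
    (hfac : IsFactored PX logging slot)
    (reward : Kernel (𝓧 × Slate d) ℝ) [IsMarkovKernel reward]
    -- the target policy
    (target : Kernel 𝓧 (Slate d)) [IsMarkovKernel target]
    (hcov : SlotCoverage PX target slot)
    -- the parameter `θ = E[G R]` exists
    (hGR : Integrable (weightedReward target slot) (obsLaw PX logging reward))
    (θ : ℝ) (hθ : θ = ∫ z, weightedReward target slot z ∂(obsLaw PX logging reward))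
    -- the iid data `(X_i, A_i, R_i)`
    (P : Measure Ω) [IsProbabilityMeasure P]
    (X : ℕ → Ω → 𝓧) (A : ℕ → Ω → Slate d) (R : ℕ → Ω → ℝ)
    (hlaw : ∀ i, HasLaw (fun ω ↦ (X i ω, A i ω, R i ω)) (obsLaw PX logging reward) P)
    (hindep : iIndepFun (fun i ω ↦ ((X i ω, A i ω, R i ω) : Obs 𝓧 d)) P)
    -- the fixed weights
    (w : Fin K → ℝ) :
    -- unbiasedness
    (Integrable (gammaCV target slot w) (obsLaw PX logging reward) ∧
      ∫ z, gammaCV target slot w z ∂(obsLaw PX logging reward) = θ ∧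
      ∀ n : ℕ, 1 ≤ n →
        Integrable (cvEstimator target slot w (fun i ω ↦ (X i ω, A i ω, R i ω)) n) P ∧
        ∫ ω, cvEstimator target slot w (fun i ω ↦ (X i ω, A i ω, R i ω)) n ω ∂P
          = ∫ z, gammaCV target slot w z ∂(obsLaw PX logging reward)) ∧
    -- asymptotic normality, when the variance `V_w` of `Γ_w` is finite
    (MemLp (gammaCV target slot w) 2 (obsLaw PX logging reward) →
      TendstoInDistribution
        (fun (n : ℕ) ω ↦
          √(n : ℝ) * (cvEstimator target slot w (fun i ω ↦ (X i ω, A i ω, R i ω)) n ω - θ))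
        atTop (id : ℝ → ℝ) (fun _ ↦ P)
        (gaussianReal 0
          (variance (gammaCV target slot w) (obsLaw PX logging reward)).toNNReal)) := by
  have hC := integrable_controlVariate (reward := reward) hfac hcov w
  have hint : Integrable (gammaCV target slot w) (obsLaw PX logging reward) := hGR.sub hC
  have hmean : ∫ z, gammaCV target slot w z ∂(obsLaw PX logging reward) = θ := by
    simp only [gammaCV]
    rw [integral_sub hGR hC, integral_controlVariate hfac hcov w, sub_zero, hθ]
  have hf := measurable_gammaCV target slot w
  have hfi i : Integrable (fun ω ↦ gammaCV target slot w (X i ω, A i ω, R i ω)) P := by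
    rw [← (hlaw i).map_eq] at hint
    exact hint.comp_aemeasurable (hlaw i).aemeasurable
  refine ⟨⟨hint, hmean, fun n hn ↦ ⟨integrable_empMean hfi n, integral_empMean hfi
    (fun i ↦ (hlaw i).integral_comp hf.aestronglyMeasurable) hn⟩⟩, fun hL2 ↦ ?_⟩
  -- The central limit theorem centres at the mean of `Γ_w`, which is `θ`.
  rw [← hmean]
  exact tendstoInDistribution_empMean hf hlaw hindep hL2
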